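/- Let $G$ be a $\sigma$-compact, locally compact (Hausdorff) abelian group. Definitions. A set $\Lambda\subset G$ is a Meyer set if it is uniformly discrete (there is an open neighbourhood $U$ of $0$ such that the sets $s+U$, $s\in\Lambda$, are pairwise disjoint), relatively dense ($\Lambda+K=G$ for some compact $K$), and $\Lambda-\Lambda\subset\Lambda+F$ for some finite $F\subset G$. $SAP(G)$ is the set of bounded uniformly continuous $f:G\to\mathbb C$ such that for every $\varepsilon>0$ the set $\{x\in G:\sup_{t\in G}|f(t)-f(t-x)|<\varepsilon\}$ is relatively dense. $G_{\mathsf b}$ is the Bohr compactification of $G$ with its canonical homomorphism $i:G\to G_{\mathsf b}$; that is, $G_{\mathsf b}$ is the closure of $\{(\chi(x))_\chi:x\in G\}$ in the product of copies of the circle group indexed by all continuous characters $\chi$ of $G$, and $i(x)=(\chi(x))_\chi$. A cut-and-project scheme $(H,\mathcal L)$ over $G$ consists of a locally compact (Hausdorff) abelian group $H$ and a discrete co-compact subgroup $\mathcal L\subset G\times H$ such that the projection $\mathcal L\to G$ is one-to-one and the projection $\mathcal L\to H$ has dense range. Let $L\subset G$ be the image of $\mathcal L$ in $G$ and, for $x\in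 L$, let $x^\star\in H$ be the unique point with $(x,x^\star)\in\mathcal L$. A set $\Lambda\subset G$ is associated to $(H,\mathcal L)$ if $\Lambda\subset\{x\in L:x^\star\in W\}$ for some $W\subset H$ with non-empty interior and compact closure. Two schemes over $G$ are compatible if they have the same associated sets. The scheme $(H,\mathcal L)$ is universal if there is a map ${}^\sharp$ from $SAP(G)$ to the bounded continuous functions $H\to\mathbb C$ with $f(x)=f^\sharp(x^\star)$ for all $f\in SAP(G)$ and $x\in L$. Proposition. For every cut-and-project scheme $S=(H,\mathcal L)$ over $G$ there is a compatible universal cut-and-project scheme over $G$. More precisely, with $$H_{\mathsf u}=\overline{\{(x^\star,i(x)):x\in L\}}\subset H\times G_{\mathsf b},\qquad \mathcal L_{\mathsf u}=\{(x,(x^\star,i(x))):x\in L\}\subset G\times H_{\mathsf u},$$ $S_{\mathsf u}=(H_{\mathsf u},\mathcal L_{\mathsf u})$ is a cut-and-project scheme over $G$ which is universal and compatible with $S$. In particular, for every Meyer set $\Lambda\subset G$ there is a universal cut-and-project scheme over $G$ to which $\Lambda$ is associated. -/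

import Mathlib

open Set Topology
open scoped Pointwise BoundedContinuousFunction

universe u v w

/-! All groups are abelian and written additively. -/

namespace CutAndProject

section Sets

variable {G : Type u} [AddCommGroup G] [TopologicalSpace G]

/-- Some open neighbourhood `U` of `0` has pairwise disjoint translates by the points of the set. -/
def IsUniformlyDiscrete (Λ : Set G) : Prop :=
  ∃ U : Set G, IsOpen U ∧ (0 : G) ∈ U ∧
    ∀ s ∈ Λ, ∀ t ∈ Λ, t ≠ s → Disjoint (s +ᵥ U) (t +ᵥ U)

def IsRelativelyDense (Λ : Set G) : Prop :=
  ∃ K : Set G, IsCompact K ∧ Λ + K = univ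

structure IsMeyerSet (Λ : Set G) : Prop where
  uniformlyDiscrete : IsUniformlyDiscrete Λ
  relativelyDense : IsRelativelyDense Λ
  sub_subset : ∃ F : Set G, F.Finite ∧ Λ - Λ ⊆ Λ + F

end Sets

section AlmostPeriodic

variable (G : Type u) [AddCommGroup G] [TopologicalSpace G] [IsTopologicalAddGroup G]

variable {G} in
/-- The translate `τ_x f`, given by `(τ_x f) t = f (t - x)`. -/
noncomputable def shift (x : G) (f : G →ᵇ ℂ) : G →ᵇ ℂ :=
  f.compContinuous ⟨fun t => t - x, continuous_id.sub continuous_const⟩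

/-- `SAP(G)`: the bounded, uniformly continuous functions `f : G → ℂ` such that for every
`ε > 0` the set of `ε`-almost periods of `f` (in the supremum norm) is relatively dense. -/
def SAP : Set (G →ᵇ ℂ) :=
  {f | (∀ ε : ℝ, 0 < ε → ∃ U ∈ 𝓝 (0 : G), ∀ s t : G, s - t ∈ U → ‖f s - f t‖ < ε) ∧
    ∀ ε : ℝ, 0 < ε → IsRelativelyDense {x : G | ‖f - shift x f‖ < ε}}

/-- Evaluation of all characters of `G`: the point `x` is sent to the family `(χ x)_χ`, where `χ`
runs through the continuous homomorphisms from `G` to the circle group. -/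
noncomputable def evalChars : G →+ ((G →ₜ+ Additive Circle) → Additive Circle) where
  toFun x χ := χ x
  map_zero' := by
    funext χ
    exact map_zero χ
  map_add' x y := by
    funext χ
    exact map_add χ x y

/-- The Bohr compactification `G_b` of `G`: the closure of the image of `G` in the product of
circles indexed by all characters of `G`. -/
noncomputable def bohr : AddSubgroup ((G →ₜ+ Additive Circle) → Additive Circle) :=
  (evalChars G).range.topologicalClosure

/-- The canonical homomorphism `i : G → G_b`. -/
noncomputable def toBohr : G →+ bohr G :=
  (evalChars G).codRestrict (bohr G) fun x =>
    AddSubgroup.le_topologicalClosure _ ⟨x, rfl⟩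

end AlmostPeriodic

section Schemes

variable {G : Type u} [AddCommGroup G] [TopologicalSpace G] [IsTopologicalAddGroup G]
  {H : Type v} [AddCommGroup H] [TopologicalSpace H] [IsTopologicalAddGroup H]
  {H' : Type w} [AddCommGroup H'] [TopologicalSpace H'] [IsTopologicalAddGroup H']

/-- `(H, ℒ)` is a cut-and-project scheme over `G`. The topological group `H` is locally compact and
Hausdorff, and `ℒ` is a discrete co-compact subgroup of `G × H` whose projection to `G` is
one-to-one and whose projection to `H` has dense range. -/
structure IsScheme (ℒ : AddSubgroup (G × H)) : Prop where
  t2Space : T2Space H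
  locallyCompactSpace : LocallyCompactSpace H
  discrete : DiscreteTopology ℒ
  cocompact : CompactSpace ((G × H) ⧸ ℒ)
  injective_fst : Function.Injective fun p : ℒ => p.1.1
  dense_snd : DenseRange fun p : ℒ => p.1.2

/-- The cut-and-project set of the window `W`: all `x ∈ L = π^G(ℒ)` with `x⋆ ∈ W`. Here `x⋆` is the
point with `(x, x⋆) ∈ ℒ`, which is unique when `(H, ℒ)` is a cut-and-project scheme. -/
def cutSet (ℒ : AddSubgroup (G × H)) (W : Set H) : Set G :=
  {x | ∃ y ∈ W, (x, y) ∈ ℒ}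

/-- `Λ` is associated to `(H, ℒ)`: it is contained in a model set from `(H, ℒ)`, that is, in the
cut-and-project set of a window with non-empty interior and compact closure. -/
def IsAssociated (ℒ : AddSubgroup (G × H)) (Λ : Set G) : Prop :=
  ∃ W : Set H, (interior W).Nonempty ∧ IsCompact (closure W) ∧ Λ ⊆ cutSet ℒ W

/-- Two schemes over `G` are compatible if they have the same associated sets. -/
def Compatible (ℒ : AddSubgroup (G × H)) (ℒ' : AddSubgroup (G × H')) : Prop :=
  ∀ Λ : Set G, IsAssociated ℒ Λ ↔ IsAssociated ℒ' Λ

/-- Universality: there is a map `♯ : SAP(G) → C_b(H)` with `f x = f♯ (x⋆)` for all `x ∈ L`. -/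
def IsUniversal (ℒ : AddSubgroup (G × H)) : Prop :=
  ∃ sharp : SAP G → (H →ᵇ ℂ), ∀ (f : SAP G) (x : G) (y : H), (x, y) ∈ ℒ → f.1 x = sharp f y

/-- The homomorphism `(x, y) ↦ (y, i x)`; on `ℒ` it is `(x, x⋆) ↦ (x⋆, i x)`. -/
noncomputable def bohrPair (G : Type u) [AddCommGroup G] [TopologicalSpace G] [IsTopologicalAddGroup G]
    (H : Type v) [AddCommGroup H] : G × H →+ H × bohr G :=
  (AddMonoidHom.snd G H).prod ((toBohr G).comp (AddMonoidHom.fst G H))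

/-- `H_u`, the closure of `{(x⋆, i x) : x ∈ L}` in `H × G_b`. -/
noncomputable def universalGroup (ℒ : AddSubgroup (G × H)) : AddSubgroup (H × bohr G) :=
  (ℒ.map (bohrPair G H)).topologicalClosure

/-- `ℒ_u = {(x, (x⋆, i x)) : x ∈ L}`, a subgroup of `G × H_u`. -/
noncomputable def universalLattice (ℒ : AddSubgroup (G × H)) : AddSubgroup (G × universalGroup ℒ) where
  carrier := {p | (p.1, p.2.1.1) ∈ ℒ ∧ p.2.1.2 = toBohr G p.1}
  zero_mem' := ⟨ℒ.zero_mem, (map_zero (toBohr G)).symm⟩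
  add_mem' := by
    rintro p q ⟨hp, hp'⟩ ⟨hq, hq'⟩
    refine ⟨ℒ.add_mem hp hq, ?_⟩
    change p.2.1.2 + q.2.1.2 = toBohr G (p.1 + q.1)
    rw [hp', hq', map_add]
  neg_mem' := by
    rintro p ⟨hp, hp'⟩
    refine ⟨ℒ.neg_mem hp, ?_⟩
    change -p.2.1.2 = toBohr G (-p.1)
    rw [hp', map_neg]

end Schemes

end CutAndProject

/-!
The scheme `(H_u, ℒ_u)` inherits everything from `(H, ℒ)` because `G_b` is compact: `ℒ_u` maps
continuously and injectively to the discrete group `ℒ`, and a compact set of representatives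
`K × C` for `ℒ` in `G × H` yields the compact set of representatives `K × (H_u ∩ (C × G_b))` for
`ℒ_u`. The projection `H_u → H` is continuous and proper, so windows can be pulled back and pushed
forward.

Universality says that a strongly almost periodic function `f` extends to `G_b`
(`exists_bohr_extension`). The completion `K` of `G` for the seminorm `x ↦ ‖f - τ_x f‖` is a compact
group through which `f` factors. Since the characters of `K` separate points
(`exists_character_apply_ne_zero`), `K` is a closed subgroup of a product of circles, and `G → K`
extends to `G_b → K`. The characters of `K` come from Gelfand duality for the commutative von Neumann
algebra generated by the translations of `L²(K)`.

A Meyer set `Λ` is associated to a scheme by the following construction. The difference set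
`A = Λ - Λ` satisfies `A + A ⊆ A + F` with `F` finite. An invariant mean of `G`, applied to
thickenings of sets by a small neighbourhood of `0`, is an invariant finitely additive content on the
subsets of `4A`, for which `A` has positive content. For such contents the argument of Massicot and
Wagner (`IsInvariantContentOn.exists_nsmul_subset`) gives a set `X` commensurable with `A` such that
`8X ⊆ 4A`. Iterating, one obtains a neighbourhood basis of `0` for a group topology on `G` in which
`4A` is a precompact neighbourhood of `0`. The completion `H` of `G` in this topology is locally
compact, and the graph of `G → H` is a lattice: it is discrete because `4A` meets some neighbourhood
of `0` in `G` only in `0`, and cocompact because `A` is relatively dense in `G`.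
-/

namespace CutAndProject

/-! ### Invariant means on abelian groups -/


section InvariantMean

variable {G : Type u} [AddCommGroup G]

/-- Abelian groups have polynomial growth. -/
theorem card_nsmul_le_succ_pow [DecidableEq G] (S : Finset G) (n : ℕ) :
    (n • S).card ≤ (n + 1) ^ S.card := by
  let T : Finset (S → ℕ) := Fintype.piFinset fun _ => Finset.range (n + 1)
  have hsub : n • S ⊆ T.image fun c => ∑ s : S, c s • (s : G) := by
    have key : ∀ k : ℕ, ∀ x ∈ k • S, ∃ c : S → ℕ, (∀ s, c s ≤ k) ∧ ∑ s : S, c s • (s : G) = x := by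
      intro k
      induction k with
      | zero =>
        intro x hx
        rw [zero_nsmul, Finset.mem_zero] at hx
        exact ⟨0, fun _ => le_rfl, by simp [hx]⟩
      | succ k ih =>
        intro x hx
        rw [succ_nsmul, Finset.mem_add] at hx
        obtain ⟨y, hy, s, hs, rfl⟩ := hx
        obtain ⟨c, hc, rfl⟩ := ih y hy
        refine ⟨c + Pi.single ⟨s, hs⟩ 1, fun t => ?_, ?_⟩
        · have h1 : (Pi.single (⟨s, hs⟩ : S) 1 : S → ℕ) t ≤ 1 := by
            rw [Pi.single_apply]; split_ifs <;> simp
          exact add_le_add (hc t) h1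
        · simp only [Pi.add_apply, add_smul, Finset.sum_add_distrib, add_right_inj]
          rw [Finset.sum_eq_single (⟨s, hs⟩ : S)]
          · simp
          · intro b _ hb
            simp [hb]
          · simp
    intro x hx
    obtain ⟨c, hc, rfl⟩ := key n x hx
    exact Finset.mem_image_of_mem _
      (Fintype.mem_piFinset.2 fun s => Finset.mem_range.2 (Nat.lt_succ_of_le (hc s)))
  calc (n • S).card ≤ T.card := (Finset.card_le_card hsub).trans Finset.card_image_le
    _ = (n + 1) ^ S.card := by simp [T]

/-- Finite Følner sets, found among the multiples `n • (S ∪ {0})`: were the growth factor at least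
`1 + ε` at each step, the growth would be exponential. -/
theorem exists_finset_card_symmDiff_le [DecidableEq G] (S : Finset G) {ε : ℝ} (hε : 0 < ε) :
    ∃ F : Finset G, F.Nonempty ∧
      ∀ g ∈ S, ((symmDiff (g +ᵥ F) F).card : ℝ) ≤ 2 * ε * F.card := by
  let T : Finset G := insert 0 S
  have h0 : (0 : G) ∈ T := Finset.mem_insert_self 0 S
  have hne : ∀ n : ℕ, (n • T).Nonempty := fun n => Finset.Nonempty.nsmul ⟨0, h0⟩
  obtain ⟨n, hn⟩ : ∃ n : ℕ, (((n + 1) • T).card : ℝ) ≤ (1 + ε) * (n • T).card := by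
    by_contra! h
    have hlow : ∀ n : ℕ, (1 + ε) ^ n ≤ ((n • T).card : ℝ) := by
      intro n
      induction n with
      | zero => simp
      | succ n ih =>
        rw [pow_succ']
        exact (mul_le_mul_of_nonneg_left ih (by positivity)).trans (h n).le
    have hlim := tendsto_pow_const_div_const_pow_of_one_lt T.card (lt_add_of_pos_right 1 hε)
    have hlim' := (hlim.comp (Filter.tendsto_add_atTop_nat 1)).const_mul (1 + ε)
    rw [mul_zero] at hlim'
    obtain ⟨n, hn⟩ := (hlim'.eventually (gt_mem_nhds one_pos)).exists
    have hup : ((n • T).card : ℝ) ≤ ((n + 1 : ℕ) : ℝ) ^ T.card := by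
      exact_mod_cast card_nsmul_le_succ_pow T n
    have hle := (hlow n).trans hup
    simp only [Function.comp_apply] at hn
    rw [pow_succ', ← mul_div_assoc, mul_div_mul_left _ _ (by positivity),
      div_lt_one (by positivity)] at hn
    exact absurd hle (not_le.2 hn)
  refine ⟨n • T, hne n, fun g hg => ?_⟩
  have h1 : n • T ⊆ (n + 1) • T := by
    rw [succ_nsmul]
    exact Finset.subset_add_left _ h0
  have h2 : g +ᵥ n • T ⊆ (n + 1) • T := by
    rw [succ_nsmul']
    intro x hx
    obtain ⟨y, hy, rfl⟩ := Finset.mem_vadd_finset.1 hx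
    exact Finset.add_mem_add (Finset.mem_insert_of_mem hg) hy
  have hsub : symmDiff (g +ᵥ n • T) (n • T) ⊆
      ((n + 1) • T \ (n • T)) ∪ ((n + 1) • T \ (g +ᵥ n • T)) := by
    intro x hx
    rcases Finset.mem_symmDiff.1 hx with ⟨hx1, hx2⟩ | ⟨hx1, hx2⟩
    · exact Finset.mem_union_left _ (Finset.mem_sdiff.2 ⟨h2 hx1, hx2⟩)
    · exact Finset.mem_union_right _ (Finset.mem_sdiff.2 ⟨h1 hx1, hx2⟩)
  have hc := (Finset.card_le_card hsub).trans (Finset.card_union_le _ _)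
  have e1 := Finset.card_sdiff_add_card_eq_card h1
  have e2 := Finset.card_sdiff_add_card_eq_card h2
  rw [Finset.card_vadd_finset] at e2
  have hc' : ((symmDiff (g +ᵥ n • T) (n • T)).card : ℝ) ≤
      (((n + 1) • T \ (n • T)).card : ℝ) + ((n + 1) • T \ (g +ᵥ n • T)).card := by
    exact_mod_cast hc
  have e1' : (((n + 1) • T \ (n • T)).card : ℝ) + (n • T).card = ((n + 1) • T).card := by
    exact_mod_cast e1
  have e2' : (((n + 1) • T \ (g +ᵥ n • T)).card : ℝ) + (n • T).card = ((n + 1) • T).card := by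
    exact_mod_cast e2
  linarith

open MeasureTheory in
/-- Abelian groups are amenable: they carry an invariant finitely additive probability measure
defined on all subsets. -/
theorem exists_invariant_mean (G : Type u) [AddCommGroup G] :
    ∃ m : Set G → ENNReal, m univ = 1 ∧ (∀ s t, Disjoint s t → m (s ∪ t) = m s + m t) ∧
      ∀ (g : G) (s : Set G), m (g +ᵥ s) = m s := by
  classical
  let : MeasurableSpace G := ⊤
  have hms : ∀ s : Set G, MeasurableSet s := fun _ => trivial
  choose F hFne hF using fun i : Finset G × ℕ =>
    exists_finset_card_symmDiff_le i.1 (ε := 1 / ((i.2 : ℝ) + 1)) (by positivity)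
  have hpos : ∀ i, (0 : ℝ) < (F i).card := fun i => by exact_mod_cast (hFne i).card_pos
  have hfoel : IsAddFoelner G Measure.count (Filter.atTop : Filter (Finset G × ℕ))
      (fun i => (F i : Set G)) := by
    refine ⟨.of_forall fun _ => hms _, .of_forall fun i => ?_, .of_forall fun i => ?_, fun g => ?_⟩
    · simpa using (hFne i).ne_empty
    · simp
    · have hlim : Filter.Tendsto (fun i : Finset G × ℕ => ENNReal.ofReal (2 * (1 / ((i.2 : ℝ) + 1))))
          Filter.atTop (𝓝 0) := by
        have h1 : Filter.Tendsto (fun n : ℕ => 2 * (1 / ((n : ℝ) + 1))) Filter.atTop (𝓝 0) := by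
          simpa using tendsto_one_div_add_atTop_nhds_zero_nat.const_mul (2 : ℝ)
        rw [← Filter.prod_atTop_atTop_eq]
        simpa using ENNReal.tendsto_ofReal (h1.comp Filter.tendsto_snd)
      refine tendsto_of_tendsto_of_tendsto_of_le_of_le' tendsto_const_nhds hlim
        (.of_forall fun _ => zero_le) ?_
      filter_upwards [Filter.eventually_ge_atTop (({g} : Finset G), 0)] with i hi
      have hg : g ∈ i.1 := hi.1 (Finset.mem_singleton_self g)
      have hb := hF i g hg
      have hcoe : symmDiff (g +ᵥ (F i : Set G)) (F i : Set G) =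
          ((symmDiff (g +ᵥ F i) (F i) : Finset G) : Set G) := by
        simp [Finset.coe_symmDiff]
      rw [hcoe, Measure.count_apply_finset, Measure.count_apply_finset]
      rw [ENNReal.div_le_iff (by simpa using (hFne i).ne_empty) (by simp)]
      rw [← ENNReal.ofReal_natCast, ← ENNReal.ofReal_natCast, ← ENNReal.ofReal_mul (by positivity)]
      exact ENNReal.ofReal_le_ofReal hb
  obtain ⟨m, h1, h2, h3⟩ := hfoel.amenable
  exact ⟨m, h1, fun s t => h2 s t (hms t), h3⟩

end InvariantMean

/-! ### Small sets inside approximate subgroups -/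

section ApproximateSubgroup

variable {G : Type u} [AddCommGroup G]

/-- A translation invariant, finite, monotone and subadditive set function on `G` which is additive
on the subsets of `Y`. -/
structure IsInvariantContentOn (μ : Set G → ENNReal) (Y : Set G) : Prop where
  mono : ∀ S T, S ⊆ T → μ S ≤ μ T
  union_le : ∀ S T, μ (S ∪ T) ≤ μ S + μ T
  vadd : ∀ (g : G) (S : Set G), μ (g +ᵥ S) = μ S
  ne_top : ∀ S, μ S ≠ ⊤
  union : ∀ S T, S ⊆ Y → T ⊆ Y → Disjoint S T → μ (S ∪ T) = μ S + μ T

namespace IsInvariantContentOn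

variable {μ : Set G → ENNReal} {Y : Set G} (h : IsInvariantContentOn μ Y)

include h

theorem empty : μ ∅ = 0 := by
  have := h.union ∅ ∅ (empty_subset _) (empty_subset _) (disjoint_empty _)
  rw [union_self] at this
  exact (ENNReal.add_right_inj (h.ne_top ∅)).1 (this.symm.trans (add_zero _).symm)

theorem inter_add_diff {S : Set G} (hS : S ⊆ Y) (T : Set G) : μ (S ∩ T) + μ (S \ T) = μ S := by
  rw [← h.union _ _ (inter_subset_left.trans hS) (sdiff_subset.trans hS)
    (disjoint_sdiff_right.mono_left inter_subset_right), inter_union_sdiff]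

theorem biUnion_eq_zero {ι : Type*} {F : Set ι} (hF : F.Finite) {S : ι → Set G}
    (hS : ∀ i ∈ F, μ (S i) = 0) : μ (⋃ i ∈ F, S i) = 0 := by
  induction F, hF using Set.Finite.induction_on with
  | empty => simpa using h.empty
  | @insert a F _ _ ih =>
    rw [biUnion_insert]
    refine le_antisymm ((h.union_le _ _).trans ?_) zero_le
    rw [hS a (mem_insert _ _), ih fun i hi => hS i (mem_insert_of_mem _ hi), add_zero]

theorem ne_zero_of_subset_add {A X F : Set G} (hA : μ A ≠ 0) (hF : F.Finite)
    (hsub : A ⊆ X + F) : μ X ≠ 0 := by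
  intro hX
  refine hA (le_antisymm ((h.mono _ _ hsub).trans ?_) zero_le)
  have : X + F = ⋃ f ∈ F, f +ᵥ X := by
    rw [add_comm]
    exact (iUnion_vadd_set F X).symm
  rw [this]
  exact (h.biUnion_eq_zero hF fun f _ => (h.vadd f X).trans hX).le

/-- If `B` is a subset of `A` of positive content then `A` is covered by finitely many translates
of the set of all `x` for which `B` and `x + B` overlap in positive content: the members of a
family of translates of `B` by elements of `A` with null overlaps lie in `A + A`, and their contents
add up. -/
theorem exists_finite_subset_add {A B : Set G} (hAY : A + A ⊆ Y) (hBA : B ⊆ A) (hB : μ B ≠ 0) :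
    ∃ F : Set G, F.Finite ∧ A ⊆ {x | μ (B ∩ (x +ᵥ B)) ≠ 0} + F := by
  by_contra! hcon
  have hpack : ∀ n : ℕ, ∃ F : Set G, F.Finite ∧ F ⊆ A ∧ n * μ B ≤ μ (F + B) := by
    intro n
    induction n with
    | zero => exact ⟨∅, finite_empty, empty_subset _, by simp⟩
    | succ n ih =>
      obtain ⟨F, hF, hFA, hle⟩ := ih
      obtain ⟨a, haA, ha⟩ := not_subset.1 (hcon F hF)
      refine ⟨insert a F, hF.insert a, insert_subset haA hFA, ?_⟩
      have hFY : F + B ⊆ Y := (add_subset_add hFA hBA).trans hAY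
      have haY : a +ᵥ B ⊆ Y := by
        rintro _ ⟨b, hb, rfl⟩
        exact hAY (add_mem_add haA (hBA hb))
      have hnull : μ ((a +ᵥ B) ∩ (F + B)) = 0 := by
        have hsub : (a +ᵥ B) ∩ (F + B) ⊆ ⋃ f ∈ F, f +ᵥ (B ∩ ((a - f) +ᵥ B)) := by
          rintro _ ⟨⟨b, hb, rfl⟩, f, hf, c, hc, hfc⟩
          refine mem_biUnion hf ⟨c, ⟨hc, b, hb, ?_⟩, hfc⟩
          change f + c = a + b at hfc
          change a - f + b = c
          rw [sub_add_eq_add_sub, ← hfc, add_sub_cancel_left]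
        refine le_antisymm ((h.mono _ _ hsub).trans (h.biUnion_eq_zero hF fun f hf => ?_).le) zero_le
        rw [h.vadd]
        by_contra hne
        exact ha ⟨a - f, hne, f, hf, sub_add_cancel a f⟩
      have hdiff : μ ((a +ᵥ B) \ (F + B)) = μ B := by
        rw [← h.vadd a B, ← h.inter_add_diff haY (F + B), hnull, zero_add]
      have hins : insert a F + B = (F + B) ∪ ((a +ᵥ B) \ (F + B)) := by
        rw [union_sdiff_self, insert_eq, union_add, singleton_add, union_comm]; rfl
      rw [hins, h.union _ _ hFY (sdiff_subset.trans haY) disjoint_sdiff_right, hdiff]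
      push_cast
      rw [add_mul, one_mul]
      gcongr
  obtain ⟨n, hn⟩ := ENNReal.exists_nat_mul_gt hB (h.ne_top (A + A))
  obtain ⟨F, -, hFA, hle⟩ := hpack n
  exact absurd (hn.trans_le hle) (not_lt.2 (h.mono _ _ (add_subset_add hFA hBA)))

/-- **Massicot–Wagner**, for abelian groups. The set `B ⊆ A` of positive content is chosen such that
the content of `B + A` is almost minimal. If `B` and `x + B` overlap in positive content, then
minimality forces `B + A` and `x + (B + A)` to be almost equal, so that sums of few such elements `x`
still move `B + A` to a set meeting it. -/
theorem exists_nsmul_subset {A : Set G} (hAY : A + A ⊆ Y) (hA0 : μ A ≠ 0) (hneg : -A = A) :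
    ∃ X : Set G, 0 ∈ X ∧ -X = X ∧ 8 • X ⊆ 4 • A ∧ ∃ F : Set G, F.Finite ∧ A ⊆ X + F := by
  set I : ENNReal := ⨅ B : {B : Set G // B ⊆ A ∧ μ B ≠ 0}, μ (B.1 + A) with hI
  have hIle : ∀ B : Set G, B ⊆ A → μ B ≠ 0 → I ≤ μ (B + A) := fun B h1 h2 =>
    iInf_le (fun B : {B : Set G // B ⊆ A ∧ μ B ≠ 0} => μ (B.1 + A)) ⟨B, h1, h2⟩
  have hI0 : I ≠ 0 := by
    have : μ A ≤ I := by
      refine le_iInf fun ⟨B, hB, hB0⟩ => ?_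
      obtain ⟨b, hb⟩ : B.Nonempty := by
        rw [nonempty_iff_ne_empty]
        rintro rfl
        exact hB0 h.empty
      rw [← h.vadd b A]
      refine h.mono _ _ ?_
      rintro _ ⟨a, ha, rfl⟩
      exact add_mem_add hb ha
    exact fun h0 => hA0 (le_antisymm (this.trans h0.le) zero_le)
  have hItop : I ≠ ⊤ := ((hIle A subset_rfl hA0).trans_lt (h.ne_top _).lt_top).ne
  -- Eight errors of size `I / 16` add up to `I / 2`, which is less than the content of `B + A`.
  obtain ⟨⟨B, hBA, hB0⟩, hB⟩ : ∃ B : {B : Set G // B ⊆ A ∧ μ B ≠ 0}, μ (B.1 + A) < I + I / 16 := by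
    apply iInf_lt_iff.1
    rw [← hI]
    exact ENNReal.lt_add_right hItop (by simp [hI0])
  set D : Set G := B + A with hD
  have hDY : D ⊆ Y := (add_subset_add_right hBA).trans hAY
  set X : Set G := {x | μ (B ∩ (x +ᵥ B)) ≠ 0} with hX
  have hsmall : ∀ x ∈ X, μ (D \ (x +ᵥ D)) ≤ I / 16 := by
    intro x hx
    have h1 : I ≤ μ (D ∩ (x +ᵥ D)) := by
      refine (hIle _ (inter_subset_left.trans hBA) hx).trans (h.mono _ _ ?_)
      rintro _ ⟨b, ⟨hb, c, hc, rfl⟩, a, ha, rfl⟩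
      exact ⟨add_mem_add hb ha, c + a, add_mem_add hc ha, (add_assoc x c a).symm⟩
    have h2 := h.inter_add_diff hDY (x +ᵥ D)
    rw [← ENNReal.add_le_add_iff_left hItop]
    calc I + μ (D \ (x +ᵥ D)) ≤ μ (D ∩ (x +ᵥ D)) + μ (D \ (x +ᵥ D)) := by gcongr
      _ = μ D := h2
      _ ≤ I + I / 16 := hB.le
  have hsmall' : ∀ k : ℕ, ∀ x ∈ k • X, μ (D \ (x +ᵥ D)) ≤ k * (I / 16) := by
    intro k
    induction k with
    | zero =>
      intro x hx
      rw [zero_nsmul, mem_zero] at hx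
      simp [hx, h.empty]
    | succ k ih =>
      intro z hz
      rw [succ_nsmul] at hz
      obtain ⟨x, hx, y, hy, rfl⟩ := hz
      have hsub : D \ ((x + y) +ᵥ D) ⊆ (D \ (x +ᵥ D)) ∪ (x +ᵥ (D \ (y +ᵥ D))) := by
        rintro d ⟨hd, hd'⟩
        by_cases hdx : d ∈ x +ᵥ D
        · right
          rw [vadd_set_sdiff, vadd_vadd]
          exact ⟨hdx, hd'⟩
        · exact Or.inl ⟨hd, hdx⟩
      refine ((h.mono _ _ hsub).trans (h.union_le _ _)).trans ?_
      rw [h.vadd]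
      push_cast
      rw [add_mul, one_mul]
      exact add_le_add (ih x hx) (hsmall y hy)
  refine ⟨X, by simpa [hX] using hB0, ?_, ?_, h.exists_finite_subset_add hAY hBA hB0⟩
  · ext x
    have : μ (B ∩ (-x +ᵥ B)) = μ (B ∩ (x +ᵥ B)) := by
      rw [← h.vadd x (B ∩ (-x +ᵥ B)), vadd_set_inter, vadd_neg_vadd, inter_comm]
    simp [hX, this]
  · intro x hx
    have hmeet : (D ∩ (x +ᵥ D)).Nonempty := by
      by_contra hcon
      have hdis : Disjoint D (x +ᵥ D) := disjoint_iff_inter_eq_empty.2 (not_nonempty_iff_eq_empty.1 hcon)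
      have h1 := hsmall' 8 x hx
      rw [hdis.sdiff_eq_left] at h1
      have h2 : ((8 : ℕ) : ENNReal) * (I / 16) = I / 2 := by
        rw [ENNReal.div_eq_inv_mul, ENNReal.div_eq_inv_mul, ← mul_assoc]
        congr 1
        rw [show (16 : ENNReal) = 8 * 2 by norm_num, ENNReal.mul_inv (by simp) (by simp), ← mul_assoc]
        push_cast
        rw [ENNReal.mul_inv_cancel (by simp) (by simp), one_mul]
      rw [h2] at h1
      exact absurd ((hIle B hBA hB0).trans h1) (not_le.2 (ENNReal.half_lt_self hI0 hItop))
    obtain ⟨_, hd, d', hd', rfl⟩ := hmeet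
    obtain ⟨b, hb, a, ha, hba⟩ := hd
    obtain ⟨b', hb', a', ha', rfl⟩ := hd'
    have hAn : ∀ y ∈ A, -y ∈ A := fun y hy => by rw [← hneg]; simpa using hy
    have hx4 : x = b + a + -b' + -a' := by
      have : b + a = x + (b' + a') := hba
      rw [this]; abel
    rw [show (4 : ℕ) = 1 + 1 + 1 + 1 from rfl, add_nsmul, add_nsmul, add_nsmul, one_nsmul, hx4]
    exact add_mem_add (add_mem_add (add_mem_add (hBA hb) ha) (hAn _ (hBA hb'))) (hAn _ ha')

omit h in
/-- Iteration of `exists_nsmul_subset` produces, below the fourfold sum of `A`, a sequence of sets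
commensurable with `A` which can serve as neighbourhoods of `0` of a group topology. -/
theorem exists_seq {A : Set G} (h : IsInvariantContentOn μ (4 • A)) (hA0 : μ A ≠ 0)
    (hneg : -A = A) (hzero : 0 ∈ A) :
    ∃ W : ℕ → Set G, W 0 = 4 • A ∧ (∀ n, 0 ∈ W n) ∧ (∀ n, -W n = W n) ∧
      (∀ n, W (n + 1) + W (n + 1) ⊆ W n) ∧ ∀ n, ∃ F : Set G, F.Finite ∧ A ⊆ W n + F := by
  let Good : Set G → Prop := fun B =>
    0 ∈ B ∧ -B = B ∧ 4 • B ⊆ 4 • A ∧ ∃ F : Set G, F.Finite ∧ A ⊆ B + F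
  have hself : ∀ {B : Set G}, 0 ∈ B → B ⊆ 4 • B := fun {B} hB => by
    have := nsmul_subset_nsmul_right hB (show 1 ≤ 4 by norm_num)
    rwa [one_nsmul] at this
  have hstep : ∀ B : {B // Good B}, ∃ C : {C // Good C}, 8 • C.1 ⊆ 4 • B.1 := by
    rintro ⟨B, hB0, hBneg, hB4, F, hF, hAB⟩
    have hBY : B + B ⊆ 4 • A := by
      refine Subset.trans ?_ hB4
      rw [← two_nsmul]
      exact nsmul_subset_nsmul_right hB0 (by norm_num)
    obtain ⟨X, hX0, hXneg, hX8, F', hF', hBX⟩ :=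
      h.exists_nsmul_subset hBY (h.ne_zero_of_subset_add hA0 hF hAB) hBneg
    refine ⟨⟨X, hX0, hXneg, (nsmul_subset_nsmul_right hX0 (by norm_num)).trans (hX8.trans hB4),
      F' + F, hF'.add hF, ?_⟩, hX8⟩
    rw [← add_assoc]
    exact hAB.trans (add_subset_add_right hBX)
  choose next hnext using hstep
  let B : ℕ → {B // Good B} := fun n =>
    Nat.rec ⟨A, hzero, hneg, subset_rfl, {0}, finite_singleton 0, by simp⟩ (fun _ C => next C) n
  refine ⟨fun n => 4 • (B n).1, rfl, fun n => hself (B n).2.1 (B n).2.1, fun n => ?_, fun n => ?_,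
    fun n => ?_⟩
  · change -(4 • (B n).1) = 4 • (B n).1
    conv_rhs => rw [← (B n).2.2.1]
    simp only [← neg_nsmul]
  · rw [← add_nsmul]
    exact hnext (B n)
  · obtain ⟨F, hF, hsub⟩ := (B n).2.2.2.2
    exact ⟨F, hF, hsub.trans (add_subset_add_right (hself (B n).2.1))⟩

end IsInvariantContentOn

end ApproximateSubgroup

/-! ### Cocompact subgroups and compact sets of representatives -/

section Cocompact

variable {X : Type*} [AddCommGroup X] [TopologicalSpace X]

theorem compactSpace_quotient {ℒ : AddSubgroup X} {C : Set X} (hC : IsCompact C)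
    (h : ∀ p, ∃ l ∈ ℒ, p - l ∈ C) : CompactSpace (X ⧸ ℒ) := by
  refine ⟨?_⟩
  have : (univ : Set (X ⧸ ℒ)) = QuotientAddGroup.mk '' C := by
    refine (eq_univ_of_forall fun q => ?_).symm
    obtain ⟨p, rfl⟩ := QuotientAddGroup.mk_surjective q
    obtain ⟨l, hl, hC⟩ := h p
    refine ⟨p - l, hC, QuotientAddGroup.eq.2 ?_⟩
    simpa using hl
  rw [this]
  exact hC.image QuotientAddGroup.continuous_mk

theorem exists_isCompact_representatives [IsTopologicalAddGroup X] [LocallyCompactSpace X]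
    (ℒ : AddSubgroup X) [CompactSpace (X ⧸ ℒ)] :
    ∃ C : Set X, IsCompact C ∧ ∀ p, ∃ l ∈ ℒ, p - l ∈ C := by
  choose N hNc hN using fun p : X => exists_compact_mem_nhds p
  obtain ⟨t, -, ht⟩ := isCompact_univ.elim_nhds_subcover
    (fun q : X ⧸ ℒ => QuotientAddGroup.mk '' N q.out) fun q _ => by
      have := QuotientAddGroup.isOpenMap_coe (N := ℒ) |>.image_mem_nhds (hN q.out)
      rwa [QuotientAddGroup.out_eq'] at this
  refine ⟨⋃ q ∈ t, N q.out, t.isCompact_biUnion fun q _ => hNc _, fun p => ?_⟩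
  obtain ⟨q, hq, c, hc, hcp⟩ := mem_iUnion₂.1 (ht (mem_univ (QuotientAddGroup.mk p)))
  refine ⟨-c + p, QuotientAddGroup.eq.1 hcp, mem_biUnion hq ?_⟩
  simpa using hc

end Cocompact

/-! ### Locally compact completions -/

section Completion

/-- A decreasing sequence of mutually commensurable sets with `W (n + 1) + W (n + 1) ⊆ W n` is a
neighbourhood basis of `0` for a group topology with locally compact Hausdorff completion. -/
theorem exists_locallyCompact_completion {G : Type u} [AddCommGroup G] {W : ℕ → Set G}
    (hzero : ∀ n, 0 ∈ W n) (hneg : ∀ n, -W n = W n) (hadd : ∀ n, W (n + 1) + W (n + 1) ⊆ W n)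
    (hfin : ∀ n, ∃ F : Set G, F.Finite ∧ W 0 ⊆ W n + F) :
    ∃ (H : Type u) (_ : AddCommGroup H) (_ : TopologicalSpace H) (_ : IsTopologicalAddGroup H)
      (_ : T2Space H) (_ : LocallyCompactSpace H) (j : G →+ H), DenseRange j ∧
      (∃ C : Set H, IsCompact C ∧ ∀ x ∈ W 0, j x ∈ C) ∧ ∃ N ∈ 𝓝 (0 : H), ∀ x, j x ∈ N → x ∈ W 0 := by
  have hanti : Antitone W := antitone_nat_of_succ_le fun n x hx =>
    hadd n (by simpa using add_mem_add hx (hzero (n + 1)))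
  let B : AddGroupFilterBasis G := addGroupFilterBasisOfComm (range W) (range_nonempty W)
    (by
      rintro _ _ ⟨m, rfl⟩ ⟨n, rfl⟩
      exact ⟨W (max m n), mem_range_self _,
        subset_inter (hanti (le_max_left m n)) (hanti (le_max_right m n))⟩)
    (by rintro _ ⟨n, rfl⟩; exact hzero n)
    (by rintro _ ⟨n, rfl⟩; exact ⟨_, mem_range_self (n + 1), hadd n⟩)
    (by rintro _ ⟨n, rfl⟩; exact ⟨_, mem_range_self n, (hneg n).symm.subset⟩)
  let : TopologicalSpace G := B.topology
  have : IsTopologicalAddGroup G := B.isTopologicalAddGroup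
  let : UniformSpace G := IsTopologicalAddGroup.rightUniformSpace G
  have : IsUniformAddGroup G := isUniformAddGroup_of_addCommGroup
  have hW0 : W 0 ∈ 𝓝 (0 : G) := B.mem_nhds_zero (mem_range_self 0)
  have htb : TotallyBounded (W 0) := by
    refine totallyBounded_iff_subset_finite_iUnion_nhds_zero.2 fun U hU => ?_
    obtain ⟨_, ⟨n, rfl⟩, hn⟩ := B.nhds_zero_hasBasis.mem_iff.1 hU
    obtain ⟨F, hF, hsub⟩ := hfin n
    refine ⟨F, hF, fun x hx => ?_⟩
    obtain ⟨y, hy, f, hf, rfl⟩ := hsub hx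
    exact mem_biUnion hf ⟨y, hn hy, add_comm f y⟩
  let j : G →+ UniformSpace.Completion G := UniformSpace.Completion.toCompl
  have hj : IsDenseInducing j := UniformSpace.Completion.isDenseInducing_toCompl G
  have hC : IsCompact (closure (j '' W 0)) :=
    isCompact_iff_totallyBounded_isComplete.2
      ⟨(htb.image (UniformSpace.Completion.uniformContinuous_coe G)).closure,
        isClosed_closure.isComplete⟩
  have hCn : closure (j '' W 0) ∈ 𝓝 (0 : UniformSpace.Completion G) := by
    have := hj.closure_image_mem_nhds hW0
    rwa [map_zero] at this
  refine ⟨UniformSpace.Completion G, inferInstance, inferInstance, inferInstance, inferInstance,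
    hC.locallyCompactSpace_of_mem_nhds_of_addGroup hCn, j, hj.dense, ⟨_, hC, fun x hx =>
      subset_closure (mem_image_of_mem j hx)⟩, ?_⟩
  rw [hj.isInducing.nhds_eq_comap, map_zero] at hW0
  exact hW0

end Completion

/-! ### Cut-and-project schemes for Meyer sets -/

section Meyer

variable {G : Type u} [AddCommGroup G] [TopologicalSpace G] [IsTopologicalAddGroup G]

theorem IsUniformlyDiscrete.finite_inter_isCompact {Λ : Set G} (hΛ : IsUniformlyDiscrete Λ)
    {K : Set G} (hK : IsCompact K) : (Λ ∩ K).Finite := by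
  obtain ⟨U, hUo, hU0, hU⟩ := hΛ
  obtain ⟨t, -, ht⟩ := hK.elim_nhds_subcover (fun x => (fun y => x - y) ⁻¹' U) fun x _ =>
    (continuous_const.sub continuous_id).continuousAt.preimage_mem_nhds
      (hUo.mem_nhds (by simpa using hU0))
  have hcov : Λ ∩ K ⊆ ⋃ x ∈ t, Λ ∩ ((fun y => x - y) ⁻¹' U) := by
    rintro y ⟨hyΛ, hyK⟩
    obtain ⟨x, hx, hxy⟩ := mem_iUnion₂.1 (ht hyK)
    exact mem_biUnion hx ⟨hyΛ, hxy⟩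
  refine (t.finite_toSet.biUnion fun x _ => Set.Subsingleton.finite ?_).subset hcov
  rintro y ⟨hy, hyU⟩ z ⟨hz, hzU⟩
  by_contra hne
  exact Set.disjoint_left.1 (hU y hy z hz (Ne.symm hne))
    (show x ∈ y +ᵥ U from ⟨x - y, hyU, add_sub_cancel y x⟩) ⟨x - z, hzU, add_sub_cancel z x⟩

/-- Finitely many translates of a uniformly discrete set have no accumulation point at `0`. -/
theorem IsUniformlyDiscrete.exists_nhds_inter_subset [T2Space G] [LocallyCompactSpace G]
    {Λ F : Set G} (hΛ : IsUniformlyDiscrete Λ) (hF : F.Finite) :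
    ∃ V ∈ 𝓝 (0 : G), ∀ x ∈ V, x ∈ Λ + F → x = 0 := by
  obtain ⟨K, hK, hK0⟩ := exists_compact_mem_nhds (0 : G)
  have hfin : ((Λ + F) ∩ K).Finite := by
    refine (hF.biUnion fun f _ => ((hΛ.finite_inter_isCompact
      (hK.image (continuous_sub_right f))).image (· + f))).subset ?_
    rintro _ ⟨⟨x, hx, f, hf, rfl⟩, hxK⟩
    exact mem_biUnion hf ⟨x, ⟨hx, x + f, hxK, add_sub_cancel_right x f⟩, rfl⟩
  refine ⟨K \ (((Λ + F) ∩ K) \ {0}), Filter.inter_mem hK0 ?_, fun x hx hxΛ => ?_⟩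
  · exact hfin.sdiff.isClosed.isOpen_compl.mem_nhds fun h => h.2 rfl
  · by_contra hne
    exact hx.2 ⟨⟨hxΛ, hx.1⟩, hne⟩

namespace IsMeyerSet

omit [IsTopologicalAddGroup G] in
theorem nonempty {Λ : Set G} (hΛ : IsMeyerSet Λ) : Λ.Nonempty := by
  obtain ⟨K, -, hK⟩ := hΛ.relativelyDense
  obtain ⟨x, hx, -⟩ : (0 : G) ∈ Λ + K := hK ▸ mem_univ 0
  exact ⟨x, hx⟩

omit [IsTopologicalAddGroup G] in
theorem exists_finite_nsmul_sub_subset {Λ : Set G} (hΛ : IsMeyerSet Λ) (n : ℕ) :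
    ∃ F : Set G, F.Finite ∧ (n + 1) • (Λ - Λ) ⊆ Λ + F := by
  obtain ⟨F, hF, hsub⟩ := hΛ.sub_subset
  have hdiff : (Λ - Λ) + (Λ - Λ) ⊆ (Λ - Λ) + (F - F) := by
    rintro _ ⟨_, ⟨a, ha, b, hb, rfl⟩, _, ⟨c, hc, d, hd, rfl⟩, rfl⟩
    obtain ⟨x, hx, f, hf, hxf⟩ := hsub (sub_mem_sub ha hb)
    obtain ⟨y, hy, g, hg, hyg⟩ := hsub (sub_mem_sub hd hc)
    refine ⟨x - y, sub_mem_sub hx hy, f - g, sub_mem_sub hf hg, ?_⟩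
    change x + f = a - b at hxf
    change y + g = d - c at hyg
    change x - y + (f - g) = a - b + (c - d)
    rw [sub_add_sub_comm, hxf, hyg]
    abel
  have key : ∃ F : Set G, F.Finite ∧ (n + 1) • (Λ - Λ) ⊆ (Λ - Λ) + F := by
    induction n with
    | zero => exact ⟨{0}, finite_singleton 0, by simp⟩
    | succ n ih =>
      obtain ⟨E, hE, hsubE⟩ := ih
      refine ⟨(F - F) + E, (hF.sub hF).add hE, ?_⟩
      rw [succ_nsmul]
      refine (add_subset_add_right hsubE).trans ?_
      rw [add_right_comm, ← add_assoc]
      exact add_subset_add_right hdiff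
  obtain ⟨E, hE, hsubE⟩ := key
  refine ⟨F + E, hF.add hE, hsubE.trans ?_⟩
  rw [← add_assoc]
  exact add_subset_add_right hsub

/-- An invariant mean of `G`, evaluated on thickenings `S + V` by a small neighbourhood `V` of `0`,
is additive on subsets `S` of the fourfold sum of the difference set of a Meyer set. -/
theorem exists_invariantContent [T2Space G] [LocallyCompactSpace G] {Λ : Set G}
    (hΛ : IsMeyerSet Λ) :
    ∃ μ : Set G → ENNReal, IsInvariantContentOn μ (4 • (Λ - Λ)) ∧ μ (Λ - Λ) ≠ 0 := by
  obtain ⟨m, hm1, hmadd, hminv⟩ := exists_invariant_mean G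
  have hmmono : ∀ S T, S ⊆ T → m S ≤ m T := fun S T hST => by
    rw [← union_sdiff_cancel hST, hmadd _ _ disjoint_sdiff_right]
    exact le_self_add
  have hm : IsInvariantContentOn m univ :=
    { mono := hmmono
      union_le := fun S T => by
        rw [← union_sdiff_self, hmadd _ _ disjoint_sdiff_right]
        gcongr
        exact hmmono _ _ sdiff_subset
      vadd := hminv
      ne_top := fun S => ne_top_of_le_ne_top ENNReal.one_ne_top (hm1 ▸ hmmono S univ (subset_univ S))
      union := fun S T _ _ => hmadd S T }
  -- Differences of elements of the fourfold sum lie in the eightfold sum of `Λ - Λ`.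
  obtain ⟨F, hF, hFsub⟩ := hΛ.exists_finite_nsmul_sub_subset 7
  obtain ⟨V₀, hV₀, hV₀F⟩ := hΛ.uniformlyDiscrete.exists_nhds_inter_subset hF
  obtain ⟨V, hVo, hV0, hVV⟩ : ∃ V : Set G, IsOpen V ∧ (0 : G) ∈ V ∧ V - V ⊆ V₀ := by
    obtain ⟨V, hV, hsub⟩ := exists_nhds_half_neg hV₀
    obtain ⟨V', hV', hVo, hV0⟩ := mem_nhds_iff.1 hV
    exact ⟨V', hVo, hV0, by
      rintro _ ⟨v, hv, w, hw, rfl⟩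
      exact hsub v (hV' hv) w (hV' hw)⟩
  refine ⟨fun S => m (S + V), ⟨fun S T hST => hm.mono _ _ (add_subset_add_right hST),
    fun S T => ?_, fun g S => ?_, fun S => hm.ne_top _, fun S T hS hT hd => ?_⟩, ?_⟩
  · rw [union_add]
    exact hm.union_le _ _
  · rw [vadd_add_assoc]
    exact hm.vadd _ _
  · rw [union_add]
    refine hmadd _ _ (disjoint_left.2 ?_)
    rintro _ ⟨s, hs, v, hv, rfl⟩ ⟨t, ht, v', hv', heq⟩
    change t + v' = s + v at heq
    have hst : s - t = v' - v := by
      rw [sub_eq_sub_iff_add_eq_add, ← heq, add_comm]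
    have h8 : s - t ∈ Λ + F := by
      refine hFsub ?_
      rw [show 7 + 1 = 4 + 4 from rfl, add_nsmul, sub_eq_add_neg s]
      refine add_mem_add (hS hs) ?_
      have : -t ∈ -(4 • (Λ - Λ)) := neg_mem_neg.2 (hT ht)
      rwa [← neg_nsmul, neg_sub] at this
    have h0 : s - t = 0 := hV₀F _ (hst ▸ hVV (sub_mem_sub hv' hv)) h8
    exact disjoint_left.1 hd hs (sub_eq_zero.1 h0 ▸ ht)
  · obtain ⟨K, hK, hΛK⟩ := hΛ.relativelyDense
    obtain ⟨a, ha⟩ := hΛ.nonempty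
    obtain ⟨t, -, ht⟩ := hK.elim_nhds_subcover (fun x => x +ᵥ V) fun x _ => by
      simpa using vadd_mem_nhds_vadd x (hVo.mem_nhds hV0)
    refine hm.ne_zero_of_subset_add (A := univ) (by simp [hm1])
      (t.finite_toSet.image (a + ·)) ?_
    rintro x -
    obtain ⟨y, hy, k, hk, rfl⟩ : x ∈ Λ + K := hΛK ▸ mem_univ x
    obtain ⟨s, hs, v, hv, rfl⟩ := mem_iUnion₂.1 (ht hk)
    refine ⟨y - a + v, add_mem_add (sub_mem_sub hy ha) hv, a + s, mem_image_of_mem _ hs, ?_⟩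
    change y - a + v + (a + s) = y + (s + v)
    abel

/-- Every Meyer set is associated to a cut-and-project scheme. The internal group is the completion
of `G` in a group topology for which the fourfold sum of `Λ - Λ` is a precompact neighbourhood of
`0`, and the lattice is the graph of the canonical map. -/
theorem exists_scheme [T2Space G] [LocallyCompactSpace G] {Λ : Set G} (hΛ : IsMeyerSet Λ) :
    ∃ (H : Type u) (_ : AddCommGroup H) (_ : TopologicalSpace H) (_ : IsTopologicalAddGroup H)
      (ℒ : AddSubgroup (G × H)), IsScheme ℒ ∧ IsAssociated ℒ Λ := by
  obtain ⟨a, ha⟩ := hΛ.nonempty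
  have h0 : (0 : G) ∈ Λ - Λ := ⟨a, ha, a, ha, sub_self a⟩
  obtain ⟨μ, hμ, hμ0⟩ := hΛ.exists_invariantContent
  obtain ⟨W, hW0, hWzero, hWneg, hWadd, hWfin⟩ := hμ.exists_seq hμ0 (neg_sub Λ Λ) h0
  have hsubW : Λ - Λ ⊆ W 0 := by
    rw [hW0]
    simpa using nsmul_subset_nsmul_right h0 (show 1 ≤ 4 by norm_num)
  obtain ⟨F, hF, hF4⟩ := hΛ.exists_finite_nsmul_sub_subset 3
  have hΛsub : Λ ⊆ (Λ - Λ) + {a} := fun x hx => ⟨x - a, sub_mem_sub hx ha, a, rfl, sub_add_cancel x a⟩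
  obtain ⟨H, _, _, _, _, _, j, hj, ⟨C, hC, hWC⟩, N, hN, hNW⟩ :=
    exists_locallyCompact_completion hWzero hWneg hWadd fun n => by
      obtain ⟨E, hE, hEsub⟩ := hWfin n
      refine ⟨E + {a} + F, (hE.add (finite_singleton a)).add hF, ?_⟩
      rw [hW0, ← add_assoc, ← add_assoc]
      exact hF4.trans (add_subset_add_right (hΛsub.trans (add_subset_add_right hEsub)))
  refine ⟨H, inferInstance, inferInstance, inferInstance, j.graph, ⟨inferInstance, inferInstance,
    ?_, ?_, ?_, ?_⟩, ?_⟩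
  · obtain ⟨V, hV, hVF⟩ := hΛ.uniformlyDiscrete.exists_nhds_inter_subset hF
    refine discreteTopology_of_isOpen_singleton_zero ?_
    have hnhds : V ×ˢ N ∈ 𝓝 ((0 : j.graph) : G × H) := prod_mem_nhds hV hN
    refine isOpen_singleton_iff_nhds_eq_pure _ |>.2 (le_antisymm ?_ (pure_le_nhds _))
    refine Filter.le_pure_iff.2
      (Filter.mem_of_superset (continuous_subtype_val.continuousAt.preimage_mem_nhds hnhds) ?_)
    rintro ⟨⟨x, y⟩, hxy⟩ ⟨hx, hy⟩
    rw [AddMonoidHom.mem_graph] at hxy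
    change j x = y at hxy
    subst hxy
    have hx0 : x = 0 := hVF x hx (hF4 (hW0 ▸ hNW x hy))
    subst hx0
    exact Subtype.ext (Prod.ext rfl (map_zero j))
  · obtain ⟨K, hK, hΛK⟩ := hΛ.relativelyDense
    obtain ⟨C₁, hC₁, hC₁0⟩ := exists_compact_mem_nhds (0 : H)
    refine compactSpace_quotient
      ((isCompact_singleton (x := a)).add hK |>.prod (hC₁.add hC.neg)) ?_
    rintro ⟨g, h⟩
    obtain ⟨x, hx⟩ := hj.exists_mem_open (isOpen_interior (s := (fun z => h - z) ⁻¹' C₁))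
      ⟨h, mem_interior_iff_mem_nhds.2
        ((continuous_const.sub continuous_id).continuousAt.preimage_mem_nhds (by simpa using hC₁0))⟩
    have hx' : h - j x ∈ C₁ := (interior_subset hx : j x ∈ (fun z => h - z) ⁻¹' C₁)
    obtain ⟨y, hy, k, hk, hyk⟩ : g - x ∈ Λ + K := hΛK ▸ mem_univ _
    change y + k = g - x at hyk
    refine ⟨(x + (y - a), j (x + (y - a))), rfl, ⟨a, rfl, k, hk, ?_⟩, h - j x, hx',
      -j (y - a), neg_mem_neg.2 (hWC _ (hsubW (sub_mem_sub hy ha))), ?_⟩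
    · change a + k = g - (x + (y - a))
      rw [← sub_sub, ← hyk]
      abel
    · change h - j x + -j (y - a) = h - j (x + (y - a))
      rw [map_add, ← sub_eq_add_neg, sub_sub]
  · rintro ⟨⟨x, y⟩, hxy⟩ ⟨⟨x', y'⟩, hxy'⟩ (rfl : x = x')
    rw [AddMonoidHom.mem_graph] at hxy hxy'
    exact Subtype.ext (Prod.ext rfl (hxy.symm.trans hxy'))
  · intro h
    refine mem_closure_iff_nhds.2 fun O hO => ?_
    obtain ⟨_, hO', x, rfl⟩ := mem_closure_iff_nhds.1 (hj h) O hO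
    exact ⟨j x, hO', ⟨(x, j x), rfl⟩, rfl⟩
  · obtain ⟨C₁, hC₁, hC₁0⟩ := exists_compact_mem_nhds (0 : H)
    -- Adjoining `C₁` provides the window with interior points.
    have hcomp : IsCompact ((C + {j a}) ∪ C₁) := (hC.add isCompact_singleton).union hC₁
    refine ⟨(C + {j a}) ∪ C₁, ⟨0, interior_mono subset_union_right
      (mem_interior_iff_mem_nhds.2 hC₁0)⟩, by rwa [hcomp.isClosed.closure_eq], fun x hx => ?_⟩
    refine ⟨j x, Or.inl ⟨j (x - a), hWC _ (hsubW (sub_mem_sub hx ha)), j a, rfl, ?_⟩, rfl⟩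
    change j (x - a) + j a = j x
    rw [← map_add, sub_add_cancel]

end IsMeyerSet

end Meyer

/-! ### Characters of compact abelian groups -/

section Characters

/-- Gelfand duality: the characters of a commutative C⋆-algebra separate its points. -/
theorem exists_starAlgHom_apply_ne_zero {B : Type*} [CStarAlgebra B] (A : StarSubalgebra ℂ B)
    (hclosed : IsClosed (A : Set B)) (hcomm : ∀ a ∈ A, ∀ b ∈ A, a * b = b * a)
    (a : A) (ha : a ≠ 0) :
    ∃ φ : A →⋆ₐ[ℂ] ℂ, Continuous φ ∧ φ a ≠ 0 := by
  have : Fact (IsClosed (A : Set B)) := ⟨hclosed⟩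
  let : CStarAlgebra A := StarSubalgebra.cstarAlgebra A (h_closed := hclosed)
  let : CommCStarAlgebra A :=
    { (inferInstance : CStarAlgebra A) with
      mul_comm := fun x y => Subtype.ext (hcomm x x.2 y y.2) }
  have hne : WeakDual.gelfandTransform ℂ A a ≠ 0 := fun h =>
    ha ((gelfandTransform_isometry A).injective (h.trans (map_zero _).symm))
  obtain ⟨φ, hφ⟩ := DFunLike.ne_iff.1 hne
  exact ⟨(φ : A →⋆ₐ[ℂ] ℂ), map_continuous φ, hφ⟩

variable {K : Type*} [AddCommGroup K] [TopologicalSpace K] [IsTopologicalAddGroup K]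
  [CompactSpace K]
  {𝓗 : Type*} [NormedAddCommGroup 𝓗] [InnerProductSpace ℂ 𝓗] [CompleteSpace 𝓗]

open MeasureTheory

omit [AddCommGroup K] [IsTopologicalAddGroup K] [CompleteSpace 𝓗] in
/-- The operators `∫ f(y) U(y) dμ(y)` attached to a strongly continuous isometric representation `U`
of a compact group. -/
theorem exists_integrated_representation [MeasurableSpace K] [BorelSpace K]
    (μ : Measure K) [IsFiniteMeasure μ]
    (U : K → 𝓗 →L[ℂ] 𝓗) (hiso : ∀ x v, ‖U x v‖ = ‖v‖) (hcont : ∀ v, Continuous fun x => U x v) :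
    ∃ T : C(K, ℂ) →L[ℂ] 𝓗 →L[ℂ] 𝓗, ∀ f v, T f v = ∫ y, f y • U y v ∂μ := by
  have hint : ∀ (f : C(K, ℂ)) (v : 𝓗), Integrable (fun y => f y • U y v) μ := fun f v =>
    (f.continuous.smul (hcont v)).integrable_of_hasCompactSupport
      (HasCompactSupport.of_compactSpace _)
  refine ⟨LinearMap.mkContinuous₂ (LinearMap.mk₂ ℂ (fun f v => ∫ y, f y • U y v ∂μ)
    (fun f g v => ?_) (fun c f v => ?_) (fun f v w => ?_) (fun c f v => ?_)) (μ.real univ)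
    (fun f v => ?_), fun f v => rfl⟩
  · simp only [ContinuousMap.add_apply, add_smul]
    exact integral_add (hint f v) (hint g v)
  · simp only [ContinuousMap.smul_apply, smul_assoc]
    exact integral_smul c _
  · simp only [map_add, smul_add]
    exact integral_add (hint f v) (hint f w)
  · simp only [map_smul, smul_comm _ c]
    exact integral_smul c _
  · refine (norm_integral_le_of_norm_le_const (C := ‖f‖ * ‖v‖) (.of_forall fun y => ?_)).trans ?_
    · rw [norm_smul, hiso]
      gcongr
      exact f.norm_coe_le_norm y
    · apply le_of_eq
      ring

/-- If `x₀` acts nontrivially in some unitary representation `U` of the compact abelian group `K`,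
then some continuous character of `K` does not vanish at `x₀`. The character is `x ↦ φ (U x)` for a
character `φ` of the bicommutant of the representation. It is continuous because
`φ (U x) φ (T f) = φ (U x * T f)` where `T f = ∫ f(y) U(y) dy`, and `x ↦ U x * T f` is norm
continuous. -/
theorem exists_character_apply_ne_zero_of_representation
    (U : K → 𝓗 →L[ℂ] 𝓗) (hzero : U 0 = 1) (hadd : ∀ x y, U (x + y) = U x * U y)
    (hiso : ∀ x v, ‖U x v‖ = ‖v‖) (hcont : ∀ v, Continuous fun x => U x v)
    (x₀ : K) (hx₀ : U x₀ ≠ 1) : ∃ χ : K →ₜ+ Additive Circle, χ x₀ ≠ 0 := by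
  let : MeasurableSpace K := borel K
  have : BorelSpace K := ⟨rfl⟩
  let μ : Measure K := Measure.addHaar
  obtain ⟨T, hT⟩ := exists_integrated_representation μ U hiso hcont
  have hint : ∀ (f : C(K, ℂ)) (v : 𝓗), Integrable (fun y => f y • U y v) μ := fun f v =>
    (f.continuous.smul (hcont v)).integrable_of_hasCompactSupport
      (HasCompactSupport.of_compactSpace _)
  -- The bicommutant of the representation is a commutative C⋆-algebra.
  let C : StarSubalgebra ℂ (𝓗 →L[ℂ] 𝓗) := StarSubalgebra.centralizer ℂ (range U)
  let A : StarSubalgebra ℂ (𝓗 →L[ℂ] 𝓗) := StarSubalgebra.centralizer ℂ (C : Set (𝓗 →L[ℂ] 𝓗))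
  have hstar : ∀ x, star (U x) * U x = 1 := fun x =>
    (ContinuousLinearMap.norm_map_iff_adjoint_comp_self (U x)).1 (hiso x)
  have hstar' : ∀ x, star (U x) = U (-x) := fun x => by
    calc star (U x) = star (U x) * (U x * U (-x)) := by rw [← hadd, add_neg_cancel, hzero, mul_one]
      _ = U (-x) := by rw [← mul_assoc, hstar, one_mul]
  have hUC : ∀ x, U x ∈ C := by
    refine fun x => (StarSubalgebra.mem_centralizer_iff ℂ).2 ?_
    rintro _ ⟨y, rfl⟩
    rw [hstar', ← hadd, ← hadd, ← hadd, ← hadd, add_comm y, add_comm (-y)]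
    exact ⟨rfl, rfl⟩
  have hAmem : ∀ a : 𝓗 →L[ℂ] 𝓗, (∀ c ∈ C, c * a = a * c) → a ∈ A := fun a h =>
    (StarSubalgebra.mem_centralizer_iff ℂ).2 fun c hc => ⟨h c hc, h _ (star_mem hc)⟩
  have hUA : ∀ x, U x ∈ A := fun x => hAmem _ fun c hc =>
    (((StarSubalgebra.mem_centralizer_iff ℂ).1 hc (U x) (mem_range_self x)).1).symm
  have hAC : A ≤ C := StarSubalgebra.centralizer_le ℂ _ _ (by rintro _ ⟨x, rfl⟩; exact hUC x)
  have hcomm : ∀ a ∈ A, ∀ b ∈ A, a * b = b * a := fun a ha b hb =>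
    ((StarSubalgebra.mem_centralizer_iff ℂ).1 hb a (hAC ha)).1
  have hclosed : IsClosed (A : Set (𝓗 →L[ℂ] 𝓗)) := by
    rw [StarSubalgebra.coe_centralizer]
    exact Set.isClosed_centralizer _
  have hTA : ∀ f, T f ∈ A := fun f => hAmem _ fun c hc => by
    ext v
    change c (T f v) = T f (c v)
    rw [hT, hT, ← c.integral_comp_comm (hint f v)]
    refine integral_congr_ae (.of_forall fun y => ?_)
    have := ((StarSubalgebra.mem_centralizer_iff ℂ).1 hc (U y) (mem_range_self y)).1
    simp only [map_smul]
    congr 1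
    exact (DFunLike.congr_fun this v).symm
  obtain ⟨f, hf⟩ : ∃ f, (U x₀ - 1) * T f ≠ 0 := by
    obtain ⟨v, hv⟩ := DFunLike.ne_iff.1 hx₀
    set w : 𝓗 := (U x₀ - 1) v with hw
    have hw0 : w ≠ 0 := sub_ne_zero.2 hv
    -- This choice makes `⟪w, T f w⟫` the integral of `‖⟪w, U y w⟫‖ ^ 2`.
    let f : C(K, ℂ) := ⟨fun y => inner ℂ (U y w) w, (hcont w).inner continuous_const⟩
    refine ⟨f, fun h0 => ?_⟩
    have h1 : T f w = 0 := by
      have : T f * (U x₀ - 1) = 0 := by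
        rw [hcomm _ (hTA f) _ (sub_mem (hUA x₀) (one_mem A)), h0]
      exact DFunLike.congr_fun this v
    have h2 : ∫ y, ‖inner ℂ w (U y w)‖ ^ 2 ∂μ = 0 := by
      have h3 : inner ℂ w (T f w) = 0 := by rw [h1, inner_zero_right]
      rw [hT, ← integral_inner (hint f w)] at h3
      have h4 : ∀ y, inner ℂ w (f y • U y w) = ((‖inner ℂ w (U y w)‖ ^ 2 : ℝ) : ℂ) := fun y => by
        change inner ℂ w ((inner ℂ (U y w) w : ℂ) • U y w) = _
        rw [inner_smul_right, ← inner_conj_symm, RCLike.conj_mul]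
        simp
      simp only [h4] at h3
      exact_mod_cast (integral_complex_ofReal.symm.trans h3)
    have hc : Continuous fun y => ‖inner ℂ w (U y w)‖ ^ 2 := by
      exact ((continuous_const.inner (hcont w)).norm).pow 2
    have h5 := (hc.integral_pos_of_hasCompactSupport_nonneg_nonzero (μ := μ)
      (HasCompactSupport.of_compactSpace _) (fun y => by positivity) (x := 0) (by
        rw [hzero]
        simpa using hw0)).ne'
    exact h5 h2
  obtain ⟨φ, hφc, hφ⟩ := exists_starAlgHom_apply_ne_zero A hclosed hcomm
    ⟨(U x₀ - 1) * T f, mul_mem (sub_mem (hUA x₀) (one_mem A)) (hTA f)⟩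
    (fun h => hf (congrArg Subtype.val h))
  let u : K → A := fun x => ⟨U x, hUA x⟩
  let t : A := ⟨T f, hTA f⟩
  have hφ' : (φ (u x₀) - 1) * φ t ≠ 0 := by
    rw [← map_one φ, ← map_sub, ← map_mul]
    exact hφ
  have hu : ∀ x y, φ (u (x + y)) = φ (u x) * φ (u y) := fun x y => by
    rw [← map_mul]
    exact congrArg φ (Subtype.ext (hadd x y))
  have hu0 : φ (u 0) = 1 := by
    rw [← map_one φ]
    exact congrArg φ (Subtype.ext hzero)
  have hnorm : ∀ x, ‖φ (u x)‖ = 1 := fun x => by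
    have h1 : star (φ (u x)) * φ (u x) = 1 := by
      rw [← map_star, ← map_mul, ← map_one φ]
      exact congrArg φ (Subtype.ext (hstar x))
    have h2 := congrArg norm h1
    rw [norm_mul, norm_star, norm_one] at h2
    nlinarith [norm_nonneg (φ (u x))]
  have hTU : ∀ x, U x * T f = T ((f.comp ⟨fun p : K × K => p.2 - p.1, by fun_prop⟩).curry x) := by
    intro x
    ext v
    change U x (T f v) = _
    rw [hT, hT, ← (U x).integral_comp_comm (hint f v)]
    refine Eq.trans ?_ (integral_add_left_eq_self (μ := μ) (fun y => f (y - x) • U y v) x)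
    refine integral_congr_ae (.of_forall fun y => ?_)
    simp [hadd]
  have hcontφ : Continuous fun x => φ (u x) := by
    have h1 : Continuous fun x => φ (u x * t) := by
      refine hφc.comp (continuous_induced_rng.2 ?_)
      change Continuous fun x => U x * T f
      simp only [hTU]
      exact T.continuous.comp (ContinuousMap.continuous _)
    have h2 : (fun x => φ (u x)) = fun x => φ (u x * t) * (φ t)⁻¹ := by
      ext x
      rw [map_mul, mul_assoc, mul_inv_cancel₀ (right_ne_zero_of_mul hφ'), mul_one]
    rw [h2]
    exact h1.mul continuous_const
  let χ : K →ₜ+ Additive Circle :=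
    { toFun := fun x => Additive.ofMul ⟨φ (u x), mem_sphere_zero_iff_norm.2 (hnorm x)⟩
      map_zero' := congrArg Additive.ofMul (Subtype.ext hu0)
      map_add' := fun x y => congrArg Additive.ofMul (Subtype.ext (hu x y))
      continuous_toFun := continuous_ofMul.comp (hcontφ.subtype_mk _) }
  refine ⟨χ, fun h => left_ne_zero_of_mul hφ' (sub_eq_zero.2 ?_)⟩
  exact congrArg Subtype.val (Additive.ofMul.injective h)

/-- The continuous characters of a compact Hausdorff abelian group separate its points, since the
regular representation on `L²` is faithful. -/
theorem exists_character_apply_ne_zero [T2Space K] {x₀ : K} (hx₀ : x₀ ≠ 0) :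
    ∃ χ : K →ₜ+ Additive Circle, χ x₀ ≠ 0 := by
  let : MeasurableSpace K := borel K
  have : BorelSpace K := ⟨rfl⟩
  let μ : Measure K := Measure.addHaar
  have hmp : ∀ x : K, MeasurePreserving (fun y => y + x) μ μ := fun x =>
    measurePreserving_add_right μ x
  let U : K → Lp ℂ 2 μ →L[ℂ] Lp ℂ 2 μ := fun x =>
    (Lp.compMeasurePreservingₗᵢ ℂ (fun y => y + x) (hmp x)).toContinuousLinearMap
  have hU : ∀ (x : K) (g : C(K, ℂ)), U x (ContinuousMap.toLp 2 μ ℂ g) =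
      ContinuousMap.toLp 2 μ ℂ (g.comp ⟨fun y => y + x, by fun_prop⟩) := fun x g => rfl
  refine exists_character_apply_ne_zero_of_representation U ?_ (fun x y => ?_) (fun x v => ?_)
    (fun v => ?_) x₀ fun h => ?_
  · ext1 v
    change Lp.compMeasurePreserving (fun y => y + 0) (hmp 0) v = v
    simp only [add_zero]
    exact Lp.compMeasurePreserving_id_apply v
  · ext1 v
    change Lp.compMeasurePreserving (fun z => z + (x + y)) (hmp (x + y)) v =
      Lp.compMeasurePreserving _ (hmp x) (Lp.compMeasurePreserving _ (hmp y) v)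
    rw [← Lp.compMeasurePreserving_comp_apply]
    simp only [← add_assoc]
    rfl
  · exact Lp.norm_compMeasurePreserving v (hmp x)
  · let F : C(K, C(K, K)) := ContinuousMap.curry ⟨fun p : K × K => p.2 + p.1, by fun_prop⟩
    exact (continuous_const (y := v)).compMeasurePreservingLp F.continuous hmp (by simp)
  · obtain ⟨g, hg0, hg1, -⟩ := exists_continuous_zero_one_of_isClosed
      (isClosed_singleton (x := (0 : K))) (isClosed_singleton (x := x₀)) (by simpa using hx₀.symm)
    let g' : C(K, ℂ) := ⟨fun y => (g y : ℂ), by fun_prop⟩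
    have h1 : ContinuousMap.toLp 2 μ ℂ (g'.comp ⟨fun y => y + x₀, by fun_prop⟩) =
        ContinuousMap.toLp 2 μ ℂ g' := by
      rw [← hU, h]; rfl
    have h2 := DFunLike.congr_fun (ContinuousMap.toLp_injective μ h1) 0
    have h3 : g (0 + x₀) = g 0 := Complex.ofReal_injective h2
    rw [zero_add, hg0 rfl, hg1 rfl] at h3
    exact one_ne_zero h3

end Characters

/-! ### Almost periodic functions and the Bohr compactification -/

section Bohr

/-- A function on a group which is uniformly continuous for a precompact seminorm factors through
the completion, which is a compact group. -/
theorem exists_compact_completion {G : Type u} [AddCommGroup G] (p : AddGroupSeminorm G)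
    (hp : ∀ ε : ℝ, 0 < ε → ∃ F : Set G, F.Finite ∧ ∀ x, ∃ y ∈ F, p (x - y) < ε)
    (f : G → ℂ) (hf : ∀ x y, ‖f x - f y‖ ≤ p (x - y)) :
    ∃ (K : Type u) (_ : AddCommGroup K) (_ : TopologicalSpace K) (_ : IsTopologicalAddGroup K)
      (_ : CompactSpace K) (_ : T2Space K) (ι : G →+ K) (F : C(K, ℂ)), (∀ x, F (ι x) = f x) ∧
      ∀ U ∈ 𝓝 (0 : K), ∃ ε : ℝ, 0 < ε ∧ ∀ x, p x < ε → ι x ∈ U := by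
  let : SeminormedAddCommGroup G := p.toSeminormedAddCommGroup
  have hnorm : ∀ x : G, ‖x‖ = p x := fun x => rfl
  have hdist : ∀ x y : G, dist x y = p (x - y) := fun x y => by
    rw [dist_eq_norm_sub, hnorm]
  have huc : UniformContinuous f := by
    refine Metric.uniformContinuous_iff.2 fun ε hε => ⟨ε, hε, fun {x y} hxy => ?_⟩
    rw [dist_eq_norm_sub]
    exact (hf x y).trans_lt ((hdist x y).symm.trans_lt hxy)
  have htb : TotallyBounded (univ : Set G) := by
    refine Metric.totallyBounded_iff.2 fun ε hε => ?_
    obtain ⟨F, hF, hcov⟩ := hp ε hε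
    refine ⟨F, hF, fun x _ => ?_⟩
    obtain ⟨y, hy, hxy⟩ := hcov x
    exact mem_biUnion hy (Metric.mem_ball.2 ((hdist x y).trans_lt hxy))
  have hK : CompactSpace (UniformSpace.Completion G) := by
    refine ⟨isCompact_iff_totallyBounded_isComplete.2 ⟨?_, isClosed_univ.isComplete⟩⟩
    have := (htb.image (UniformSpace.Completion.uniformContinuous_coe G)).closure
    rwa [image_univ, (UniformSpace.Completion.denseRange_coe (α := G)).closure_range] at this
  refine ⟨UniformSpace.Completion G, inferInstance, inferInstance, inferInstance, hK, inferInstance,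
    UniformSpace.Completion.toCompl,
    ⟨UniformSpace.Completion.extension f, UniformSpace.Completion.continuous_extension⟩,
    fun x => UniformSpace.Completion.extension_coe huc x, fun U hU => ?_⟩
  obtain ⟨ε, hε, hball⟩ := Metric.mem_nhds_iff.1 hU
  refine ⟨ε, hε, fun x hx => hball (mem_ball_zero_iff.2 ?_)⟩
  change ‖(x : UniformSpace.Completion G)‖ < ε
  rwa [UniformSpace.Completion.norm_coe, hnorm]

variable {G : Type u} [AddCommGroup G] [TopologicalSpace G] [IsTopologicalAddGroup G]

theorem norm_sub_shift_le_iff (f : G →ᵇ ℂ) (x : G) {c : ℝ} (hc : 0 ≤ c) :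
    ‖f - shift x f‖ ≤ c ↔ ∀ t, ‖f t - f (t - x)‖ ≤ c :=
  BoundedContinuousFunction.norm_le hc

theorem norm_apply_sub_le (f : G →ᵇ ℂ) (x t : G) : ‖f t - f (t - x)‖ ≤ ‖f - shift x f‖ :=
  (norm_sub_shift_le_iff f x (norm_nonneg _)).1 le_rfl t

/-- The seminorm `x ↦ ‖f - τ_x f‖` on `G`. -/
noncomputable def shiftSeminorm (f : G →ᵇ ℂ) : AddGroupSeminorm G where
  toFun x := ‖f - shift x f‖
  map_zero' := le_antisymm ((norm_sub_shift_le_iff f 0 le_rfl).2 (by simp)) (norm_nonneg _)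
  add_le' x y := (norm_sub_shift_le_iff f _ (by positivity)).2 fun t => by
    have h1 := norm_apply_sub_le f x t
    have h2 := norm_apply_sub_le f y (t - x)
    rw [← sub_add_sub_cancel (f t) (f (t - x)), ← sub_sub]
    exact (norm_add_le _ _).trans (add_le_add h1 h2)
  neg' x := by
    have key : ∀ z : G, ‖f - shift (-z) f‖ ≤ ‖f - shift z f‖ := fun z =>
      (norm_sub_shift_le_iff f _ (norm_nonneg _)).2 fun t => by
        have := norm_apply_sub_le f z (t + z)
        rwa [add_sub_cancel_right, norm_sub_rev, ← sub_neg_eq_add] at this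
    exact le_antisymm (key x) (by simpa using key (-x))

omit [IsTopologicalAddGroup G] in
variable (G) in
theorem denseRange_toBohr : DenseRange (toBohr G) := by
  intro b
  rw [closure_subtype, ← range_comp]
  exact b.2

omit [IsTopologicalAddGroup G] in
theorem isClosed_bohr : IsClosed (bohr G : Set ((G →ₜ+ Additive Circle) → Additive Circle)) :=
  AddSubgroup.isClosed_topologicalClosure _

instance compactSpace_bohr : CompactSpace (bohr G) :=
  isCompact_iff_compactSpace.1 isClosed_bohr.isCompact

omit [IsTopologicalAddGroup G] in
/-- A continuous homomorphism to a compact Hausdorff abelian group extends to the Bohr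
compactification: the target embeds into a product of circles. -/
theorem exists_continuous_bohr_lift {K : Type*} [AddCommGroup K] [TopologicalSpace K]
    [IsTopologicalAddGroup K] [CompactSpace K] [T2Space K] (ι : G →ₜ+ K) :
    ∃ g : bohr G → K, Continuous g ∧ ∀ x, g (toBohr G x) = ι x := by
  let e : K → (K →ₜ+ Additive Circle) → Additive Circle := fun k χ => χ k
  have he : Continuous e := continuous_pi fun χ => χ.continuous_toFun
  have hinj : Function.Injective e := by
    intro k l hkl
    by_contra hne
    obtain ⟨χ, hχ⟩ := exists_character_apply_ne_zero (sub_ne_zero.2 hne)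
    exact hχ (by rw [map_sub, sub_eq_zero]; exact congrFun hkl χ)
  have hemb : IsClosedEmbedding e := he.isClosedEmbedding hinj
  let r : bohr G → (K →ₜ+ Additive Circle) → Additive Circle := fun b χ => b.1 (χ.comp ι)
  have hr : Continuous r :=
    continuous_pi fun χ => (continuous_apply (χ.comp ι)).comp continuous_subtype_val
  have hri : ∀ x, r (toBohr G x) = e (ι x) := fun x => rfl
  have hmem : ∀ b, r b ∈ range e := fun b =>
    (denseRange_toBohr G).induction_on b (hemb.isClosed_range.preimage hr)
      fun x => ⟨ι x, (hri x).symm⟩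
  choose g hg using hmem
  refine ⟨g, hemb.isInducing.continuous_iff.2 ?_, fun x => hinj ((hg _).trans (hri x))⟩
  rw [show e ∘ g = r from funext hg]
  exact hr

/-- Almost periodic functions extend to the Bohr compactification. The completion of `G` for the
seminorm `x ↦ ‖f - τ_x f‖` is a compact group through which `f` factors. -/
theorem exists_bohr_extension (f : SAP G) :
    ∃ F : bohr G →ᵇ ℂ, ∀ x, F (toBohr G x) = f.1 x := by
  obtain ⟨f, hfu, hfp⟩ := f
  have hnear : ∀ ε : ℝ, 0 < ε → {x | shiftSeminorm f x < ε} ∈ 𝓝 (0 : G) := by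
    intro ε hε
    obtain ⟨U, hU, hfU⟩ := hfu (ε / 2) (half_pos hε)
    refine Filter.mem_of_superset hU fun x hx => ?_
    refine lt_of_le_of_lt ((norm_sub_shift_le_iff f x (half_pos hε).le).2 fun t => ?_)
      (half_lt_self hε)
    exact (hfU t (t - x) (by rwa [sub_sub_cancel])).le
  have hpre : ∀ ε : ℝ, 0 < ε →
      ∃ F : Set G, F.Finite ∧ ∀ x, ∃ y ∈ F, shiftSeminorm f (x - y) < ε := by
    intro ε hε
    obtain ⟨C, hC, hcov⟩ := hfp (ε / 2) (half_pos hε)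
    obtain ⟨t, -, ht⟩ := hC.elim_nhds_subcover
      (fun x => (fun y => y - x) ⁻¹' {z | shiftSeminorm f z < ε / 2}) fun x _ =>
        (continuous_id.sub continuous_const).continuousAt.preimage_mem_nhds
          (by simpa using hnear (ε / 2) (half_pos hε))
    refine ⟨t, t.finite_toSet, fun x => ?_⟩
    obtain ⟨q, hq, c, hc, rfl⟩ := hcov.symm.subset (mem_univ x)
    obtain ⟨y, hy, hcy⟩ := mem_iUnion₂.1 (ht hc)
    refine ⟨y, hy, ?_⟩
    calc shiftSeminorm f (q + c - y) ≤ shiftSeminorm f q + shiftSeminorm f (c - y) := by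
          rw [add_sub_assoc]
          exact map_add_le_add _ _ _
      _ < ε / 2 + ε / 2 := add_lt_add hq hcy
      _ = ε := add_halves ε
  obtain ⟨K, _, _, _, _, _, ι, F, hF, hι⟩ :=
    exists_compact_completion (shiftSeminorm f) hpre f fun x y => by
      have := norm_apply_sub_le f (x - y) x
      rwa [sub_sub_cancel] at this
  have hιc : Continuous ι := by
    refine continuous_of_continuousAt_zero ι ?_
    rw [ContinuousAt, map_zero]
    intro U hU
    obtain ⟨ε, hε, hsub⟩ := hι U hU
    exact Filter.mem_map.2 (Filter.mem_of_superset (hnear ε hε) hsub)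
  obtain ⟨g, hg, hgι⟩ := exists_continuous_bohr_lift (⟨ι, hιc⟩ : G →ₜ+ K)
  refine ⟨BoundedContinuousFunction.mkOfCompact (F.comp ⟨g, hg⟩), fun x => ?_⟩
  change F (g (toBohr G x)) = f x
  rw [hgι]
  exact hF x

end Bohr

/-! ### The universal scheme -/

section Universal

variable {G : Type u} [AddCommGroup G] [TopologicalSpace G] [IsTopologicalAddGroup G]
  {H : Type v} [AddCommGroup H] [TopologicalSpace H] [IsTopologicalAddGroup H]
  {ℒ : AddSubgroup (G × H)}

theorem mem_universalLattice {p : G × universalGroup ℒ} :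
    p ∈ universalLattice ℒ ↔ (p.1, p.2.1.1) ∈ ℒ ∧ p.2.1.2 = toBohr G p.1 := Iff.rfl

variable (ℒ) in
theorem isClosed_universalGroup : IsClosed (universalGroup ℒ : Set (H × bohr G)) :=
  AddSubgroup.isClosed_topologicalClosure _

theorem mem_universalGroup_of_mem {x : G} {y : H} (h : (x, y) ∈ ℒ) :
    (y, toBohr G x) ∈ universalGroup ℒ :=
  AddSubgroup.le_topologicalClosure _ ⟨(x, y), h, rfl⟩

/-- The preimage in `H_u` of a compact subset of `H` is compact. -/
theorem isCompact_preimage_universalGroup {C : Set H} (hC : IsCompact C) :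
    IsCompact {p : universalGroup ℒ | p.1.1 ∈ C} := by
  have := (isClosed_universalGroup ℒ).isClosedEmbedding_subtypeVal.isCompact_preimage
    (hC.prod (isCompact_univ (X := bohr G)))
  simpa [preimage, mem_prod] using this

theorem dense_universalLattice_snd : DenseRange fun p : universalLattice ℒ => p.1.2 := by
  rintro ⟨b, hb⟩
  rw [closure_subtype, ← range_comp]
  refine closure_mono ?_ hb
  rintro _ ⟨⟨x, y⟩, hxy, rfl⟩
  exact ⟨⟨(x, ⟨(y, toBohr G x), mem_universalGroup_of_mem hxy⟩), hxy, rfl⟩, rfl⟩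

theorem isScheme_universalLattice [LocallyCompactSpace G] (h : IsScheme ℒ) :
    IsScheme (universalLattice ℒ) := by
  have := h.t2Space
  have := h.locallyCompactSpace
  have := h.discrete
  have := h.cocompact
  refine ⟨inferInstance, (isClosed_universalGroup ℒ).isClosedEmbedding_subtypeVal.locallyCompactSpace,
    ?_, ?_, ?_, dense_universalLattice_snd⟩
  · let π : universalLattice ℒ → ℒ := fun p => ⟨(p.1.1, p.1.2.1.1), p.2.1⟩
    have hπ : Continuous π := by
      refine Continuous.subtype_mk ?_ _
      fun_prop
    refine DiscreteTopology.of_continuous_injective hπ ?_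
    rintro ⟨⟨x, ⟨⟨y, b⟩, hyb⟩⟩, hp, hb⟩ ⟨⟨x', ⟨⟨y', b'⟩, hyb'⟩⟩, hp', hb'⟩ heq
    obtain ⟨rfl, rfl⟩ : x = x' ∧ y = y' := Prod.ext_iff.1 (congrArg Subtype.val heq)
    change b = toBohr G x at hb
    change b' = toBohr G x at hb'
    subst hb hb'
    rfl
  · obtain ⟨C, hC, hcov⟩ := exists_isCompact_representatives ℒ
    refine compactSpace_quotient ((hC.image continuous_fst).prod
      (isCompact_preimage_universalGroup (ℒ := ℒ) (hC.image continuous_snd))) ?_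
    rintro ⟨g, q⟩
    obtain ⟨⟨x, y⟩, hxy, hmem⟩ := hcov (g, q.1.1)
    exact ⟨(x, ⟨(y, toBohr G x), mem_universalGroup_of_mem hxy⟩), ⟨hxy, rfl⟩,
      mem_image_of_mem Prod.fst hmem, mem_image_of_mem Prod.snd hmem⟩
  · rintro ⟨⟨x, ⟨⟨y, b⟩, hyb⟩⟩, hp, hb⟩ ⟨⟨x', ⟨⟨y', b'⟩, hyb'⟩⟩, hp', hb'⟩ (rfl : x = x')
    have hy : y = y' := by
      have := h.injective_fst (a₁ := ⟨(x, y), hp⟩) (a₂ := ⟨(x, y'), hp'⟩) rfl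
      exact (Prod.ext_iff.1 (congrArg Subtype.val this)).2
    subst hy
    change b = toBohr G x at hb
    change b' = toBohr G x at hb'
    subst hb hb'
    rfl

variable (ℒ) in
theorem isUniversal_universalLattice : IsUniversal (universalLattice ℒ) := by
  choose F hF using exists_bohr_extension (G := G)
  refine ⟨fun f => (F f).compContinuous ⟨fun p : universalGroup ℒ => p.1.2, by fun_prop⟩,
    fun f x y hxy => ?_⟩
  change f.1 x = F f y.1.2
  rw [(mem_universalLattice.1 hxy).2, hF]

theorem compatible_universalLattice (h : IsScheme ℒ) : Compatible ℒ (universalLattice ℒ) := by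
  have := h.t2Space
  have := h.locallyCompactSpace
  refine fun Λ => ⟨?_, ?_⟩
  · rintro ⟨W, hWi, hWc, hΛ⟩
    let W' : Set (universalGroup ℒ) := {p | p.1.1 ∈ W}
    have hcont : Continuous fun p : universalGroup ℒ => p.1.1 := by fun_prop
    refine ⟨W', ?_, ?_, fun x hx => ?_⟩
    · obtain ⟨⟨⟨x, y⟩, hxy⟩, hy⟩ := h.dense_snd.exists_mem_open isOpen_interior hWi
      refine ⟨⟨(y, toBohr G x), mem_universalGroup_of_mem hxy⟩, ?_⟩
      exact interior_maximal (preimage_mono interior_subset) (isOpen_interior.preimage hcont) hy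
    · exact (isCompact_preimage_universalGroup hWc).of_isClosed_subset isClosed_closure
        (closure_minimal (fun p hp => subset_closure hp) (isClosed_closure.preimage hcont))
    · obtain ⟨y, hy, hxy⟩ := hΛ hx
      exact ⟨⟨(y, toBohr G x), mem_universalGroup_of_mem hxy⟩, hy, hxy, rfl⟩
  · rintro ⟨W, -, hWc, hΛ⟩
    -- The image of the window need not have interior points, so a neighbourhood is adjoined.
    obtain ⟨C, hC, hC0⟩ := exists_compact_mem_nhds (0 : H)
    let C' : Set H := (fun p : universalGroup ℒ => p.1.1) '' closure W
    have hC' : IsCompact (C' ∪ C) := (hWc.image (by fun_prop)).union hC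
    refine ⟨C' ∪ C, ⟨0, interior_mono subset_union_right (mem_interior_iff_mem_nhds.2 hC0)⟩,
      by rwa [hC'.isClosed.closure_eq], fun x hx => ?_⟩
    obtain ⟨p, hp, hxp⟩ := hΛ hx
    exact ⟨p.1.1, Or.inl ⟨p, subset_closure hp, rfl⟩, hxp.1⟩

end Universal

end CutAndProject

theorem proposition3p3 {G : Type u} [AddCommGroup G] [TopologicalSpace G]
    [IsTopologicalAddGroup G] [T2Space G] [LocallyCompactSpace G] [SigmaCompactSpace G] :
    (∀ (H : Type v) [AddCommGroup H] [TopologicalSpace H] [IsTopologicalAddGroup H]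
        (ℒ : AddSubgroup (G × H)), CutAndProject.IsScheme ℒ →
      CutAndProject.IsScheme (CutAndProject.universalLattice ℒ) ∧
      CutAndProject.IsUniversal (CutAndProject.universalLattice ℒ) ∧
      CutAndProject.Compatible ℒ (CutAndProject.universalLattice ℒ)) ∧
    (∀ Λ : Set G, CutAndProject.IsMeyerSet Λ →
      ∃ (H : Type u) (_ : AddCommGroup H) (_ : TopologicalSpace H) (_ : IsTopologicalAddGroup H)
        (ℒ : AddSubgroup (G × H)), CutAndProject.IsScheme ℒ ∧ CutAndProject.IsUniversal ℒ ∧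
          CutAndProject.IsAssociated ℒ Λ) := by
  refine ⟨fun H _ _ _ ℒ h => ⟨CutAndProject.isScheme_universalLattice h,
    CutAndProject.isUniversal_universalLattice ℒ, CutAndProject.compatible_universalLattice h⟩,
    fun Λ hΛ => ?_⟩
  obtain ⟨H, _, _, _, ℒ, h, hassoc⟩ := hΛ.exists_scheme
  exact ⟨CutAndProject.universalGroup ℒ, inferInstance, inferInstance, inferInstance,
    CutAndProject.universalLattice ℒ, CutAndProject.isScheme_universalLattice h,
    CutAndProject.isUniversal_universalLattice ℒ,
    (CutAndProject.compatible_universalLattice h Λ).1 hassoc⟩
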